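/- Let $\chi$ be a primitive real Dirichlet character modulo $q$ (its values lie in $\{-1,0,1\}$), let $L(s,\chi)$ be its $L$-function, and let $\beta_0$ be an exceptional zero of $L(s,\chi)$, that is, a real number with $L(\beta_0,\chi)=0$ and $\beta_0\ge 1-\dfrac{1}{R_0\log\max\{q,10\}}$, where $R_0=9.6459$. Let $\sigma\in(\beta_0,1)$. 1. If $\chi$ is odd, $q>4\cdot 10^5$ and $\beta_0\ge 1-\dfrac{800}{\sqrt q\,\log^2 q}$, then $|L'(\sigma,\chi)|\le 0.18\,\log^2 q$. 2. If $\chi$ is even, $q>4\cdot 10^5$ and $\beta_0\ge 1-\dfrac{515}{\sqrt q\,\log^2 q}$, then $|L'(\sigma,\chi)|\le 0.1536\,\log^2 q$. 3. If $\chi$ is even, $q>10^7$ and $\beta_0\ge 1-\dfrac{80}{\sqrt q\,\log^2 q}$, then $|L'(\sigma,\chi)|\le 0.15\,\log^2 q$. -/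

import Mathlib

/-- The real number `β` is an exceptional zero of `L(s, χ)`, where `χ` is a Dirichlet character
modulo `q`: it is a zero in the zero-free-up-to-one-zero region
`Re s ≥ 1 - 1 / (R₀ log max {q, q|Im s|, 10})`, `R₀ = 9.6459`, written here at the real point
`s = β`, where `Im s = 0`. -/
def IsExceptionalZero {q : ℕ} [NeZero q] (χ : DirichletCharacter ℂ q) (β : ℝ) : Prop :=
  1 - (9.6459 * Real.log (max (q : ℝ) 10))⁻¹ ≤ β ∧
    DirichletCharacter.LFunction χ (β : ℂ) = 0

/-!
Weight `χ` by tents: `T(y) = ∑ χ(n) max (min (n, y - n), 0)`. The Mellin transform of `T` at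
`-s - 1` is `(1 - 2⁻ˢ) L(s, χ) / (s (s + 1))`. Trivially `|T(y)| ≤ y² / 4`; moreover, since the tent
is a convolution of two intervals, Cauchy–Schwarz, Parseval and `|τ(χ)| = √q` give
`|T(y)| ≤ √q y / 2` with no logarithmic loss. Differentiate the Mellin integral in `s` and recentre
the logarithm to `log y - log Y` at the price of a multiple of `L(s, χ)`. With `Y = √q / 2`, the
trivial bound for `y ≤ Y` and the second one beyond give, for `σ` near `1`,
`|L'(σ)| ≤ log Y · |L(σ)| + Y ^ (1 - σ) (log² Y / 2 + O(1))`, with main term about `log² q / 8`.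
Starting from a zero `β₀` with `(1 - β₀) log q` at most about `0.104`, Grönwall's inequality and the
power of `Y` together cost only a factor about `exp (0.104)`.
-/

section FourierBounds

open Finset

open scoped ZMod

variable {q : ℕ} [NeZero q]

lemma sum_norm_sq_dft (f : ZMod q → ℂ) : ∑ k, ‖𝓕 f k‖ ^ 2 = q * ∑ x, ‖f x‖ ^ 2 := by
  have conj_dft (k : ZMod q) : (starRingEnd ℂ) (𝓕 f k) =
      ∑ x, (starRingEnd ℂ) (f x) * ZMod.stdAddChar (x * k) := by
    simp only [ZMod.dft_apply, map_sum, smul_eq_mul, map_mul, AddChar.map_neg_eq_conj,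
      Complex.conj_conj, mul_comm]
  have inversion (x : ZMod q) : ∑ k, ZMod.stdAddChar (x * k) * 𝓕 f k = q * f x := by
    simpa [ZMod.dft_apply (𝓕 f), mul_comm x] using congrFun (ZMod.dft_dft f) (-x)
  have key : ∑ k, (starRingEnd ℂ) (𝓕 f k) * 𝓕 f k = q * ∑ x, (starRingEnd ℂ) (f x) * f x := by
    simp_rw [conj_dft, sum_mul, mul_assoc]
    rw [sum_comm]
    simp_rw [← mul_sum, inversion, mul_left_comm _ (q : ℂ), ← mul_sum]
  simp_rw [Complex.conj_mul'] at key
  exact_mod_cast key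

lemma natCast_mul_sum_sum_mul_apply_add (Φ f g : ZMod q → ℂ) :
    (q : ℂ) * ∑ x, ∑ y, f x * g y * Φ (x + y) = ∑ k, 𝓕 Φ k * 𝓕 f (-k) * 𝓕 g (-k) := by
  have inversion (x : ZMod q) : q * Φ x = ∑ k, 𝓕 Φ k * ZMod.stdAddChar (x * k) := by
    simpa [ZMod.dft_apply (𝓕 Φ), mul_comm] using (congrFun (ZMod.dft_dft Φ) (-x)).symm
  calc (q : ℂ) * ∑ x, ∑ y, f x * g y * Φ (x + y)
      = ∑ x, ∑ y, ∑ k, f x * g y * (𝓕 Φ k * ZMod.stdAddChar ((x + y) * k)) := by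
        simp_rw [mul_sum, mul_left_comm (q : ℂ), inversion, mul_sum]
    _ = ∑ k, ∑ x, ∑ y, f x * g y * (𝓕 Φ k * ZMod.stdAddChar ((x + y) * k)) := by
        rw [sum_congr rfl fun x _ ↦ sum_comm, sum_comm]
    _ = ∑ k, 𝓕 Φ k * 𝓕 f (-k) * 𝓕 g (-k) := by
        refine sum_congr rfl fun k _ ↦ ?_
        rw [mul_assoc, ZMod.dft_apply f, ZMod.dft_apply g, sum_mul_sum, mul_sum]
        refine sum_congr rfl fun x _ ↦ ?_
        rw [mul_sum]
        refine sum_congr rfl fun y _ ↦ ?_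
        simp only [mul_neg, neg_neg, smul_eq_mul]
        rw [add_mul, AddChar.map_add_eq_mul]
        ring

variable {Φ : ZMod q → ℂ} {C : ℝ}

lemma norm_sum_sum_mul_apply_add_le (hΦ : ∀ k, ‖𝓕 Φ k‖ ≤ C) (f g : ZMod q → ℂ) :
    ‖∑ x, ∑ y, f x * g y * Φ (x + y)‖ ≤ C * (√(∑ x, ‖f x‖ ^ 2) * √(∑ y, ‖g y‖ ^ 2)) := by
  have hq : (0 : ℝ) < q := by exact_mod_cast NeZero.pos q
  have hC : 0 ≤ C := (norm_nonneg _).trans (hΦ 0)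
  have parseval (f : ZMod q → ℂ) : ∑ k, ‖𝓕 f (-k)‖ ^ 2 = q * ∑ x, ‖f x‖ ^ 2 :=
    (Equiv.sum_comp (Equiv.neg _) fun k ↦ ‖𝓕 f k‖ ^ 2).trans (sum_norm_sq_dft f)
  refine le_of_mul_le_mul_left ?_ hq
  calc q * ‖∑ x, ∑ y, f x * g y * Φ (x + y)‖
      = ‖∑ k, 𝓕 Φ k * 𝓕 f (-k) * 𝓕 g (-k)‖ := by
        rw [← natCast_mul_sum_sum_mul_apply_add, norm_mul, Complex.norm_natCast]
    _ ≤ ∑ k, C * (‖𝓕 f (-k)‖ * ‖𝓕 g (-k)‖) := by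
        refine norm_sum_le_of_le _ fun k _ ↦ ?_
        rw [norm_mul, norm_mul, mul_assoc]
        gcongr
        exact hΦ k
    _ ≤ C * (√(∑ k, ‖𝓕 f (-k)‖ ^ 2) * √(∑ k, ‖𝓕 g (-k)‖ ^ 2)) := by
        rw [← mul_sum]
        gcongr
        exact Real.sum_mul_le_sqrt_mul_sqrt _ _ _
    _ = q * (C * (√(∑ x, ‖f x‖ ^ 2) * √(∑ y, ‖g y‖ ^ 2))) := by
        rw [parseval, parseval, Real.sqrt_mul hq.le, Real.sqrt_mul hq.le, mul_mul_mul_comm,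
          Real.mul_self_sqrt hq.le]
        ring

lemma norm_sum_sum_apply_add_le (hΦ : ∀ k, ‖𝓕 Φ k‖ ≤ C) (I J : Finset (ZMod q)) :
    ‖∑ x ∈ I, ∑ y ∈ J, Φ (x + y)‖ ≤ C * (√(#I) * √(#J)) := by
  simpa [apply_ite, ite_pow, ite_mul, ← mul_sum] using
    norm_sum_sum_mul_apply_add_le hΦ
      (fun x ↦ if x ∈ I then 1 else 0) (fun y ↦ if y ∈ J then 1 else 0)

lemma sum_range_natCast_add_eq_sum_univ (f : ZMod q → ℂ) (a : ZMod q) :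
    ∑ i ∈ range q, f (i + a) = ∑ x, f x :=
  sum_bij' (fun i _ ↦ (i : ZMod q) + a) (fun x _ ↦ (x - a).val) (by simp)
    (by simp [ZMod.val_lt]) (fun i hi ↦ by simp [ZMod.val_cast_of_lt (mem_range.mp hi)])
    (by simp) (by simp)

lemma exists_finset_forall_sum_range_eq_sum (a : ZMod q) (N : ℕ) :
    ∃ I : Finset (ZMod q), #I ≤ N ∧
      ∀ f : ZMod q → ℂ, ∑ x, f x = 0 → ∑ i ∈ range N, f (i + a) = ∑ x ∈ I, f x := by
  induction N using Nat.strong_induction_on with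
  | _ N ih =>
    rcases lt_or_ge N q with hN | hN
    · refine ⟨(range N).image fun i : ℕ ↦ (i : ZMod q) + a,
        card_image_le.trans_eq (card_range N), fun f _ ↦ ?_⟩
      refine (sum_image fun i hi j hj hij ↦ ?_).symm
      rw [coe_range, Set.mem_Iio] at hi hj
      rwa [add_left_inj, ZMod.natCast_eq_natCast_iff', Nat.mod_eq_of_lt (hi.trans hN),
        Nat.mod_eq_of_lt (hj.trans hN)] at hij
    · obtain ⟨M, rfl⟩ := Nat.exists_eq_add_of_le hN
      obtain ⟨I, hI, hsum⟩ := ih M (by have := NeZero.pos q; lia)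
      refine ⟨I, by lia, fun f hf ↦ ?_⟩
      rw [sum_range_add, sum_range_natCast_add_eq_sum_univ, hf, zero_add, ← hsum f hf]
      simp only [Nat.cast_add, CharP.cast_eq_zero, zero_add]

lemma norm_sum_range_sum_range_apply_add_le (hΦ₀ : ∑ x, Φ x = 0) (hΦ : ∀ k, ‖𝓕 Φ k‖ ≤ C)
    (N M : ℕ) (a : ZMod q) :
    ‖∑ i ∈ range N, ∑ j ∈ range M, Φ (i + (j + a))‖ ≤ C * (√N * √M) := by
  have hC : 0 ≤ C := (norm_nonneg _).trans (hΦ 0)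
  obtain ⟨I, hI, sum_I⟩ := exists_finset_forall_sum_range_eq_sum (0 : ZMod q) N
  obtain ⟨J, hJ, sum_J⟩ := exists_finset_forall_sum_range_eq_sum a M
  have sum_left (b : ZMod q) : ∑ x, Φ (b + x) = 0 :=
    (Equiv.sum_comp (Equiv.addLeft b) Φ).trans hΦ₀
  have sum_right (b : ZMod q) : ∑ x, Φ (x + b) = 0 :=
    (Equiv.sum_comp (Equiv.addRight b) Φ).trans hΦ₀
  have key : ∑ i ∈ range N, ∑ j ∈ range M, Φ (i + (j + a)) = ∑ x ∈ I, ∑ y ∈ J, Φ (x + y) := by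
    simp_rw [fun i : ℕ ↦ sum_J (fun y ↦ Φ (i + y)) (sum_left i)]
    rw [sum_comm, sum_comm (s := I)]
    exact sum_congr rfl fun y _ ↦ by simpa using sum_I (fun x ↦ Φ (x + y)) (sum_right y)
  rw [key]
  refine (norm_sum_sum_apply_add_le hΦ I J).trans ?_
  gcongr

end FourierBounds

section Primitive

open scoped ZMod

variable {q : ℕ} [NeZero q] {χ : DirichletCharacter ℂ q}

lemma norm_dft_le_sqrt_of_isPrimitive (hχ : χ.IsPrimitive) (k : ZMod q) : ‖𝓕 χ k‖ ≤ √q := by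
  set G := gaussSum χ ZMod.stdAddChar
  have norm_dft (k : ZMod q) : ‖𝓕 χ k‖ = ‖χ (-k)‖ * ‖G‖ := by
    rw [hχ.fourierTransform_eq_inv_mul_gaussSum, norm_mul, ← MulChar.star_apply', norm_star]
  have parseval := sum_norm_sq_dft (χ : ZMod q → ℂ)
  simp_rw [norm_dft, mul_pow, ← Finset.sum_mul] at parseval
  have sum_neg : ∑ j : ZMod q, ‖χ (-j)‖ ^ 2 = ∑ j : ZMod q, ‖χ j‖ ^ 2 :=
    Equiv.sum_comp (Equiv.neg _) fun j ↦ ‖χ j‖ ^ 2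
  rw [sum_neg, mul_comm] at parseval
  have sum_pos : 0 < ∑ j : ZMod q, ‖χ j‖ ^ 2 :=
    Finset.sum_pos' (fun _ _ ↦ by positivity) ⟨1, Finset.mem_univ _, by simp⟩
  have norm_G : ‖G‖ = √q := by
    rw [← mul_right_cancel₀ sum_pos.ne' parseval, Real.sqrt_sq (norm_nonneg G)]
  rw [norm_dft, norm_G]
  exact mul_le_of_le_one_left (Real.sqrt_nonneg _) (χ.norm_le_one _)

lemma sum_eq_zero_of_isPrimitive (hχ : χ.IsPrimitive) (hq : 1 < q) : ∑ j, χ j = 0 := by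
  refine MulChar.sum_eq_zero_of_ne_one ?_
  rintro rfl
  rw [DirichletCharacter.isPrimitive_def, DirichletCharacter.conductor_one] at hχ
  exact hq.ne hχ

end Primitive

section Tent

open Finset

/-- The difference of ramps `(y - n)⁺ - (y - 2n)⁺`, which as a function of `n` is a tent supported
on `[0, y]` with apex at `y / 2`. -/
noncomputable def tent (y : ℝ) (n : ℕ) : ℝ := max (y - n) 0 - max (y - 2 * n) 0

lemma tent_zero_right (y : ℝ) : tent y 0 = 0 := by
  simp [tent]

lemma tent_nonneg (y : ℝ) (n : ℕ) : 0 ≤ tent y n := by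
  have : (0 : ℝ) ≤ n := n.cast_nonneg
  exact sub_nonneg.mpr (max_le_max_right _ (by linarith))

lemma tent_eq_zero {y : ℝ} {n : ℕ} (hy : y ≤ n) : tent y n = 0 := by
  have : (0 : ℝ) ≤ n := n.cast_nonneg
  rw [tent, max_eq_right (by linarith), max_eq_right (by linarith), sub_zero]

lemma continuous_tent (n : ℕ) : Continuous fun y ↦ tent y n := by
  unfold tent
  fun_prop

lemma tent_natCast_add_eq_tsub {N M : ℕ} (hNM : N ≤ M) (hMN : M ≤ N + 1) (n : ℕ) :
    tent (N + M) n = (min N n - (n - M) : ℕ) := by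
  rcases le_or_gt n N with hn | hn
  · have hn' : (n : ℝ) ≤ N := by exact_mod_cast hn
    have hNM' : (N : ℝ) ≤ M := by exact_mod_cast hNM
    rw [tent, max_eq_left (by linarith), max_eq_left (by linarith), min_eq_right hn,
      Nat.sub_eq_zero_of_le (hn.trans hNM), Nat.sub_zero]
    ring
  · have hn' : (N : ℝ) + 1 ≤ n := by exact_mod_cast hn
    have hMN' : (M : ℝ) ≤ N + 1 := by exact_mod_cast hMN
    rw [tent, max_eq_right (a := _ - 2 * _) (by linarith), sub_zero, min_eq_left hn.le]
    rcases le_total n (N + M) with hnNM | hnNM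
    · have : N - (n - M) = N + M - n := by lia
      have hnNM' : (n : ℝ) ≤ N + M := by exact_mod_cast hnNM
      rw [max_eq_left (by linarith), this, Nat.cast_sub hnNM, Nat.cast_add]
    · have : N - (n - M) = 0 := by lia
      have hnNM' : (N : ℝ) + M ≤ n := by exact_mod_cast hnNM
      rw [max_eq_right (by linarith), this, Nat.cast_zero]

lemma tent_natCast_add (k n : ℕ) {t : ℝ} (ht₀ : 0 ≤ t) (ht₁ : t ≤ 1) :
    tent (k + t) n = (1 - t) * tent k n + t * tent (k + 1) n := by
  have ramp (m : ℕ) : max (k + t - m) 0 =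
      (1 - t) * max ((k : ℝ) - m) 0 + t * max ((k : ℝ) + 1 - m) 0 := by
    rcases le_or_gt m k with hm | hm
    · have : (m : ℝ) ≤ k := by exact_mod_cast hm
      rw [max_eq_left (by linarith), max_eq_left (by linarith), max_eq_left (by linarith)]
      ring
    · have : (k : ℝ) + 1 ≤ m := by exact_mod_cast hm
      rw [max_eq_right (by linarith), max_eq_right (by linarith), max_eq_right (by linarith)]
      ring
  have ramp_two_mul := ramp (2 * n)
  rw [Nat.cast_mul, Nat.cast_ofNat] at ramp_two_mul
  rw [tent, tent, tent, ramp n, ramp_two_mul]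
  ring

lemma sum_range_sum_range_add_one {E : Type*} [AddCommMonoid E] (a : ℕ → E) (N M : ℕ) :
    ∑ i ∈ range N, ∑ j ∈ range M, a (i + j + 1) =
      ∑ n ∈ range (N + M), (min N n - (n - M)) • a n := by
  calc ∑ i ∈ range N, ∑ j ∈ range M, a (i + j + 1)
      = ∑ i ∈ range N, ∑ n ∈ Ico (i + 1) (i + 1 + M), a n := by
        simp_rw [sum_Ico_eq_sum_range, add_tsub_cancel_left, add_right_comm _ _ 1]
    _ = ∑ n ∈ range (N + M), ∑ _i ∈ Ico (n - M) (min N n), a n := by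
        refine sum_comm' fun _ _ ↦ ?_
        simp only [mem_range, mem_Ico]
        lia
    _ = ∑ n ∈ range (N + M), (min N n - (n - M)) • a n := by
        simp only [sum_const, Nat.card_Ico]

/-- The sum of the sequence `a` smoothed by the tent on `[0, y]`; the terms with `n ≥ y` vanish. -/
noncomputable def tentSum (a : ℕ → ℂ) (y : ℝ) : ℂ := ∑ n ∈ range ⌈y⌉₊, a n * tent y n

variable (a : ℕ → ℂ) {y : ℝ}

lemma hasSum_tentSum (y : ℝ) : HasSum (fun n ↦ a n * (tent y n : ℂ)) (tentSum a y) := by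
  refine hasSum_sum_of_ne_finset_zero fun n hn ↦ ?_
  rw [tent_eq_zero (Nat.ceil_le.mp (by simpa using hn)), Complex.ofReal_zero, mul_zero]

lemma tentSum_eq_sum_range {K : ℕ} (hy : y ≤ K) :
    tentSum a y = ∑ n ∈ range K, a n * (tent y n : ℂ) := by
  refine (hasSum_tentSum a y).unique (hasSum_sum_of_ne_finset_zero fun n hn ↦ ?_)
  rw [tent_eq_zero (hy.trans (by simpa using hn)), Complex.ofReal_zero, mul_zero]

lemma tentSum_eq_zero (hy : y ≤ 1) : tentSum a y = 0 := by
  rw [tentSum_eq_sum_range a (K := 1) (by simpa using hy), sum_range_one, tent_zero_right,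
    Complex.ofReal_zero, mul_zero]

lemma continuous_tentSum : Continuous (tentSum a) := by
  refine continuous_iff_continuousAt.mpr fun y ↦ ?_
  obtain ⟨K, hK⟩ := exists_nat_gt y
  have hsum : Continuous fun y ↦ ∑ n ∈ range K, a n * (tent y n : ℂ) :=
    continuous_finsetSum _ fun n _ ↦
      continuous_const.mul (Complex.continuous_ofReal.comp (continuous_tent n))
  refine hsum.continuousAt.congr ?_
  filter_upwards [Iio_mem_nhds hK] with x hx
  exact (tentSum_eq_sum_range a (le_of_lt hx)).symm

lemma tentSum_natCast_add_natCast {N M : ℕ} (hNM : N ≤ M) (hMN : M ≤ N + 1) :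
    tentSum a (N + M) = ∑ i ∈ range N, ∑ j ∈ range M, a (i + j + 1) := by
  rw [sum_range_sum_range_add_one, tentSum_eq_sum_range a (K := N + M) (by simp)]
  refine sum_congr rfl fun n _ ↦ ?_
  rw [tent_natCast_add_eq_tsub hNM hMN, Complex.ofReal_natCast, nsmul_eq_mul, mul_comm]

lemma tentSum_natCast_add (k : ℕ) {t : ℝ} (ht₀ : 0 ≤ t) (ht₁ : t ≤ 1) :
    tentSum a (k + t) = (1 - t : ℝ) * tentSum a k + t * tentSum a (k + 1) := by
  rw [tentSum_eq_sum_range a (K := k + 1) (by push_cast; linarith),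
    tentSum_eq_sum_range a (y := k) (K := k + 1) (by simp),
    tentSum_eq_sum_range a (y := k + 1) (K := k + 1) (by simp), mul_sum, mul_sum,
    ← sum_add_distrib]
  refine sum_congr rfl fun n _ ↦ ?_
  rw [tent_natCast_add k n ht₀ ht₁]
  push_cast
  ring

lemma exists_norm_tentSum_le (hy : 0 ≤ y) : ∃ (N M : ℕ) (t : ℝ),
    0 ≤ t ∧ t ≤ 1 ∧ N + M + t = y ∧ ‖tentSum a y‖ ≤
      (1 - t) * ‖∑ i ∈ range N, ∑ j ∈ range M, a (i + j + 1)‖ +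
        t * ‖∑ i ∈ range M, ∑ j ∈ range (N + 1), a (i + j + 1)‖ := by
  obtain ⟨N, M, hk, hNM, hMN⟩ : ∃ N M, N + M = ⌊y⌋₊ ∧ N ≤ M ∧ M ≤ N + 1 :=
    ⟨⌊y⌋₊ / 2, ⌊y⌋₊ - ⌊y⌋₊ / 2, by lia, by lia, by lia⟩
  have hk' : (N : ℝ) + M = ⌊y⌋₊ := by exact_mod_cast hk
  have ht₀ : 0 ≤ y - ⌊y⌋₊ := sub_nonneg.mpr (Nat.floor_le hy)
  have ht₁ : y - ⌊y⌋₊ ≤ 1 := by linarith [Nat.lt_floor_add_one y]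
  have tentSum_floor_add_one : tentSum a (⌊y⌋₊ + 1) =
      ∑ i ∈ range M, ∑ j ∈ range (N + 1), a (i + j + 1) := by
    rw [← tentSum_natCast_add_natCast a hMN (by lia), ← hk', Nat.cast_add_one]
    congr 1
    ring
  have interpolation := tentSum_natCast_add a ⌊y⌋₊ ht₀ ht₁
  rw [add_sub_cancel, ← hk', tentSum_natCast_add_natCast a hNM hMN, hk', tentSum_floor_add_one]
    at interpolation
  refine ⟨N, M, y - ⌊y⌋₊, ht₀, ht₁, by linarith, ?_⟩
  rw [interpolation]
  refine (norm_add_le _ _).trans_eq ?_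
  rw [norm_mul, norm_mul, Complex.norm_of_nonneg (by linarith), Complex.norm_of_nonneg ht₀]

variable {a}

lemma norm_tentSum_le_sq (ha : ∀ n, ‖a n‖ ≤ 1) (hy : 0 ≤ y) : ‖tentSum a y‖ ≤ y ^ 2 / 4 := by
  obtain ⟨N, M, t, ht₀, ht₁, rfl, hle⟩ := exists_norm_tentSum_le a hy
  have norm_sum_le (N M : ℕ) : ‖∑ i ∈ range N, ∑ j ∈ range M, a (i + j + 1)‖ ≤ N * M :=
    (norm_sum_le_of_le _ fun i _ ↦ norm_sum_le_of_le _ fun j _ ↦ ha (i + j + 1)).trans_eq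
      (by simp)
  calc ‖tentSum a (N + M + t)‖ ≤ (1 - t) * (N * M) + t * (M * (N + 1 : ℕ)) := by
        grw [hle, norm_sum_le, norm_sum_le]
        exact sub_nonneg.mpr ht₁
    _ = M * (N + t) := by
        push_cast
        ring
    _ ≤ (N + M + t) ^ 2 / 4 := by linarith [sq_nonneg (N + t - M)]

lemma norm_tentSum_le_mul {C : ℝ}
    (ha : ∀ N M, ‖∑ i ∈ range N, ∑ j ∈ range M, a (i + j + 1)‖ ≤ C * (√N * √M)) (hy : 0 ≤ y) :
    ‖tentSum a y‖ ≤ C * (y / 2) := by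
  obtain ⟨N, M, t, ht₀, ht₁, rfl, hle⟩ := exists_norm_tentSum_le a hy
  have hC : 0 ≤ C := by simpa using (norm_nonneg _).trans (ha 1 1)
  have sqrt_mul_sqrt_le (N M : ℕ) : √N * √M ≤ (N + M) / 2 := by
    linarith [sq_nonneg (√N - √M), Real.sq_sqrt (Nat.cast_nonneg (α := ℝ) N),
      Real.sq_sqrt (Nat.cast_nonneg (α := ℝ) M)]
  calc ‖tentSum a (N + M + t)‖
      ≤ (1 - t) * (C * ((N + M) / 2)) + t * (C * ((M + (N + 1 : ℕ)) / 2)) := by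
        have : 0 ≤ 1 - t := sub_nonneg.mpr ht₁
        grw [hle, ha, ha, sqrt_mul_sqrt_le, sqrt_mul_sqrt_le]
    _ = C * ((N + M + t) / 2) := by
        push_cast
        ring

lemma isBigO_tentSum_nhds_zero (b : ℝ) :
    tentSum a =O[nhdsWithin 0 (Set.Ioi 0)] fun y : ℝ ↦ y ^ (-b) := by
  refine Asymptotics.IsBigO.of_bound 0 ?_
  filter_upwards [Ioo_mem_nhdsGT (zero_lt_one' ℝ)] with y hy
  rw [tentSum_eq_zero a hy.2.le, norm_zero, zero_mul]

end Tent

section PeriodicTent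

open Filter Asymptotics

open scoped ZMod

variable {q : ℕ} [NeZero q] {Φ : ZMod q → ℂ}

lemma norm_tentSum_le_of_norm_dft_le {C y : ℝ} (hΦ₀ : ∑ x, Φ x = 0) (hΦ : ∀ k, ‖𝓕 Φ k‖ ≤ C)
    (hy : 0 ≤ y) : ‖tentSum (Φ ·) y‖ ≤ C * (y / 2) := by
  refine norm_tentSum_le_mul (fun N M ↦ ?_) hy
  simpa [add_assoc] using norm_sum_range_sum_range_apply_add_le hΦ₀ hΦ N M 1

lemma isBigO_tentSum_atTop (hΦ₀ : ∑ x, Φ x = 0) :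
    tentSum (Φ ·) =O[atTop] fun y : ℝ ↦ y ^ (-(-1) : ℝ) := by
  obtain ⟨C, hC⟩ := Finite.exists_le fun k ↦ ‖𝓕 Φ k‖
  refine IsBigO.of_bound (C / 2) ?_
  filter_upwards [eventually_ge_atTop 0] with y hy
  rw [neg_neg, Real.rpow_one, Real.norm_of_nonneg hy]
  exact (norm_tentSum_le_of_norm_dft_le hΦ₀ hC hy).trans_eq (by ring)

end PeriodicTent

section Mellin

open Complex MeasureTheory Set Filter

lemma hasMellin_ramp {c : ℝ} (hc : 0 < c) {s : ℂ} (hs : 0 < s.re) :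
    HasMellin (fun y : ℝ ↦ ((max (y - c) 0 : ℝ) : ℂ)) (-s - 1)
      ((c : ℂ) ^ (-s) / (s * (s + 1))) := by
  have hs₀ : s ≠ 0 := ne_zero_of_re_pos hs
  have hs₁ : s + 1 ≠ 0 := ne_zero_of_re_pos (by simp; linarith)
  have hc₀ : (c : ℂ) ≠ 0 := by exact_mod_cast hc.ne'
  have integrand_eq : EqOn (fun y : ℝ ↦ (y : ℂ) ^ (-s - 1 - 1) • ((max (y - c) 0 : ℝ) : ℂ))
      ((Ioi c).indicator fun y : ℝ ↦ (y : ℂ) ^ (-s - 1) - c * (y : ℂ) ^ (-s - 2)) (Ioi 0) := by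
    intro y (hy : 0 < y)
    rcases le_or_gt y c with h | h
    · rw [indicator_of_notMem (by simpa using h)]
      simp [max_eq_right (sub_nonpos.mpr h)]
    · have hpow : (y : ℂ) ^ (-s - 1) = (y : ℂ) ^ (-s - 2) * y := by
        rw [show -s - 1 = -s - 2 + 1 by ring, cpow_add _ _ (by exact_mod_cast hy.ne'), cpow_one]
      simp only [indicator_of_mem (mem_Ioi.mpr h), max_eq_left (sub_nonneg.mpr h.le), hpow,
        smul_eq_mul, sub_sub, one_add_one_eq_two]
      push_cast
      ring
  have integrable_cpow : IntegrableOn (fun y : ℝ ↦ (y : ℂ) ^ (-s - 1)) (Ioi c) :=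
    integrableOn_Ioi_cpow_of_lt (by simp; linarith) hc
  have integrable_mul_cpow : IntegrableOn (fun y : ℝ ↦ (c : ℂ) * (y : ℂ) ^ (-s - 2)) (Ioi c) :=
    (integrableOn_Ioi_cpow_of_lt (by simp; linarith) hc).const_mul _
  constructor
  · rw [MellinConvergent, integrableOn_congr_fun integrand_eq measurableSet_Ioi]
    exact ((integrable_cpow.sub integrable_mul_cpow).integrable_indicator
      measurableSet_Ioi).integrableOn
  · have hs₂ : -s - 1 ≠ 0 := fun h ↦ hs₁ (by linear_combination -h)
    rw [mellin, setIntegral_congr_fun measurableSet_Ioi integrand_eq,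
      setIntegral_indicator measurableSet_Ioi, inter_eq_right.mpr (Ioi_subset_Ioi hc.le),
      integral_sub integrable_cpow integrable_mul_cpow, integral_const_mul,
      integral_Ioi_cpow_of_lt (by simp; linarith) hc,
      integral_Ioi_cpow_of_lt (by simp; linarith) hc, show -s - 1 + 1 = -s by ring,
      show -s - 2 + 1 = -s - 1 by ring, cpow_sub _ _ hc₀, cpow_one]
    field_simp
    ring

lemma hasMellin_tent (n : ℕ) {s : ℂ} (hs : 0 < s.re) :
    HasMellin (fun y ↦ (tent y n : ℂ)) (-s - 1)
      ((1 - 2 ^ (-s)) / (s * (s + 1)) * (n : ℂ) ^ (-s)) := by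
  rcases n.eq_zero_or_pos with rfl | hn
  · have : -s ≠ 0 := neg_ne_zero.mpr (ne_zero_of_re_pos hs)
    simp [tent_zero_right, HasMellin, MellinConvergent, mellin, zero_cpow this]
  · have hn' : (0 : ℝ) < n := by exact_mod_cast hn
    have ramp := hasMellin_ramp hn' hs
    have ramp_two_mul := hasMellin_ramp (mul_pos two_pos hn') hs
    have h := hasMellin_sub ramp.1 ramp_two_mul.1
    rw [ramp.2, ramp_two_mul.2, ofReal_mul, mul_cpow_ofReal_nonneg zero_le_two hn'.le] at h
    convert h using 1
    · ext y
      simp [tent]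
    · push_cast
      ring

lemma integral_norm_cpow_smul_ofReal {g : ℝ → ℝ} (hg : ∀ y, 0 ≤ g y) (s : ℂ) :
    ∫ y in Ioi (0 : ℝ), ‖(y : ℂ) ^ (s - 1) • (g y : ℂ)‖ = ‖mellin (fun y ↦ (g y : ℂ)) s.re‖ := by
  have mellin_eq : mellin (fun y ↦ (g y : ℂ)) s.re =
      (∫ y in Ioi (0 : ℝ), y ^ (s.re - 1) * g y : ℝ) := by
    rw [mellin, ← integral_complex_ofReal]
    refine setIntegral_congr_fun measurableSet_Ioi fun y (hy : 0 < y) ↦ ?_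
    simp only [smul_eq_mul]
    push_cast [ofReal_cpow hy.le]
    rfl
  rw [mellin_eq, norm_real, Real.norm_of_nonneg]
  · refine setIntegral_congr_fun measurableSet_Ioi fun y hy ↦ ?_
    simp only [norm_smul, norm_cpow_eq_rpow_re_of_pos hy, sub_re, one_re, norm_real,
      Real.norm_of_nonneg (hg y)]
  · exact setIntegral_nonneg measurableSet_Ioi fun y (hy : 0 < y) ↦
      mul_nonneg (Real.rpow_nonneg hy.le _) (hg y)

lemma mellin_tentSum {a : ℕ → ℂ} {s : ℂ} (hs : 0 < s.re) (ha : LSeriesSummable a s) :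
    mellin (tentSum a) (-s - 1) = (1 - 2 ^ (-s)) / (s * (s + 1)) * LSeries a s := by
  let F (n : ℕ) (y : ℝ) : ℂ := (y : ℂ) ^ (-s - 1 - 1) • (a n * tent y n)
  have term_eq (n : ℕ) : LSeries.term a s n = a n * (n : ℂ) ^ (-s) := by
    rw [LSeries.term_of_ne_zero' (ne_zero_of_re_pos hs), cpow_neg, div_eq_mul_inv]
  have mellin_F (n : ℕ) : IntegrableOn (F n) (Ioi 0) ∧
      ∫ y in Ioi 0, F n y = (1 - 2 ^ (-s)) / (s * (s + 1)) * LSeries.term a s n := by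
    have h := hasMellin_const_smul (hasMellin_tent n hs).1 (a n)
    refine ⟨h.1, h.2.trans ?_⟩
    rw [(hasMellin_tent n hs).2, term_eq, smul_eq_mul, mul_left_comm]
  have integral_norm_F (n : ℕ) : ∫ y in Ioi 0, ‖F n y‖ =
      ‖(1 - 2 ^ (-s.re : ℂ)) / (s.re * (s.re + 1) : ℂ)‖ * ‖LSeries.term a s n‖ := by
    have norm_F (y : ℝ) : ‖F n y‖ = ‖a n‖ * ‖(y : ℂ) ^ (-s - 1 - 1) • (tent y n : ℂ)‖ := by
      simp only [F, norm_smul, norm_mul, mul_left_comm]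
    have re_eq : ((-s - 1).re : ℂ) = -(s.re : ℂ) - 1 := by simp
    have norm_cpow : ‖(n : ℂ) ^ (-(s.re : ℂ))‖ = ‖(n : ℂ) ^ (-s)‖ := by
      rw [norm_natCast_cpow_of_re_ne_zero n (by simpa using hs.ne'),
        norm_natCast_cpow_of_re_ne_zero n (by simpa using hs.ne')]
      simp
    simp_rw [norm_F]
    rw [integral_const_mul, integral_norm_cpow_smul_ofReal (tent_nonneg · n), re_eq,
      (hasMellin_tent n (by simpa using hs)).2, norm_mul, norm_cpow, term_eq, norm_mul,
      mul_left_comm]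
  have summable_integral_norm : Summable fun n ↦ ∫ y in Ioi 0, ‖F n y‖ := by
    simp_rw [integral_norm_F]
    exact ha.norm.mul_left _
  calc mellin (tentSum a) (-s - 1) = ∫ y in Ioi 0, ∑' n, F n y := by
        simp only [mellin, F, tsum_const_smul'', (hasSum_tentSum a _).tsum_eq]
    _ = ∑' n, ∫ y in Ioi 0, F n y :=
        (hasSum_integral_of_summable_integral_norm (fun n ↦ (mellin_F n).1)
          summable_integral_norm).tsum_eq.symm
    _ = (1 - 2 ^ (-s)) / (s * (s + 1)) * LSeries a s := by
        simp_rw [(mellin_F _).2, tsum_mul_left, LSeries]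

end Mellin

section Continuation

open Complex Set Filter

variable {q : ℕ} [NeZero q] {Φ : ZMod q → ℂ}

lemma mellinConvergent_tentSum (hΦ₀ : ∑ x, Φ x = 0) {s : ℂ} (hs : 0 < s.re) :
    MellinConvergent (tentSum (Φ ·)) (-s - 1) :=
  mellinConvergent_of_isBigO_rpow (b := -s.re - 2)
    ((continuous_tentSum _).locallyIntegrable.locallyIntegrableOn _) (isBigO_tentSum_atTop hΦ₀)
    (by simp; linarith) (isBigO_tentSum_nhds_zero _) (by simp)

lemma mellinConvergent_log_smul_and_hasDerivAt_mellin_tentSum (hΦ₀ : ∑ x, Φ x = 0) {s : ℂ}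
    (hs : 0 < s.re) :
    MellinConvergent (fun y ↦ Real.log y • tentSum (Φ ·) y) (-s - 1) ∧
      HasDerivAt (fun z ↦ mellin (tentSum (Φ ·)) (-z - 1))
        (-mellin (fun y ↦ Real.log y • tentSum (Φ ·) y) (-s - 1)) s := by
  obtain ⟨convergent, deriv_mellin⟩ := mellin_hasDerivAt_of_isBigO_rpow (s := -s - 1)
    (b := -s.re - 2) ((continuous_tentSum (Φ ·)).locallyIntegrable.locallyIntegrableOn _)
    (isBigO_tentSum_atTop hΦ₀) (by simp; linarith) (isBigO_tentSum_nhds_zero _) (by simp)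
  exact ⟨convergent, (HasDerivAt.comp (h₂ := mellin (tentSum (Φ ·))) s deriv_mellin
    ((hasDerivAt_id s).neg.sub_const 1)).congr_deriv (mul_neg_one _)⟩

lemma mul_mellin_tentSum_eq_mul_LFunction (hΦ₀ : ∑ x, Φ x = 0) {s : ℂ} (hs : 0 < s.re) :
    s * (s + 1) * mellin (tentSum (Φ ·)) (-s - 1) = (1 - 2 ^ (-s)) * ZMod.LFunction Φ s := by
  have isOpen_re (x : ℝ) : IsOpen {z : ℂ | x < z.re} := isOpen_lt continuous_const continuous_re
  have analytic_left : AnalyticOnNhd ℂ (fun z ↦ z * (z + 1) * mellin (tentSum (Φ ·)) (-z - 1))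
      {z | 0 < z.re} := by
    refine DifferentiableOn.analyticOnNhd (fun z hz ↦ ?_) (isOpen_re 0)
    have hm := (mellinConvergent_log_smul_and_hasDerivAt_mellin_tentSum hΦ₀ hz).2.differentiableAt
    exact DifferentiableAt.differentiableWithinAt (by fun_prop)
  have analytic_right : AnalyticOnNhd ℂ (fun z ↦ (1 - 2 ^ (-z)) * ZMod.LFunction Φ z)
      {z | 0 < z.re} := by
    refine DifferentiableOn.analyticOnNhd (fun z _ ↦ ?_) (isOpen_re 0)
    have hL := ZMod.differentiable_LFunction_of_sum_zero hΦ₀ z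
    have hpow : DifferentiableAt ℂ (fun z : ℂ ↦ (2 : ℂ) ^ (-z)) z :=
      differentiableAt_id.neg.const_cpow (Or.inl two_ne_zero)
    exact ((hpow.const_sub 1).mul hL).differentiableWithinAt
  refine analytic_left.eqOn_of_preconnected_of_eventuallyEq analytic_right
    (convex_halfSpace_re_gt 0).isPreconnected (z₀ := 2) (by simp) ?_ hs
  filter_upwards [(isOpen_re 1).mem_nhds (by simp : 1 < (2 : ℂ).re)] with z (hz : 1 < z.re)
  have hz₀ : z ≠ 0 := ne_zero_of_one_lt_re hz
  have hz₁ : z + 1 ≠ 0 := ne_zero_of_re_pos (by simp; linarith)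
  rw [mellin_tentSum (by linarith) (ZMod.LSeriesSummable_of_one_lt_re Φ hz),
    ZMod.LFunction_eq_LSeries Φ hz]
  field_simp

end Continuation

section LogIntegrals

open MeasureTheory Set Filter Asymptotics Topology

variable {Y σ : ℝ}

lemma intervalIntegrable_log_sub_log_div (hY : 1 ≤ Y) :
    IntervalIntegrable (fun y ↦ (Real.log Y - Real.log y) / y) volume 1 Y := by
  refine ContinuousOn.intervalIntegrable fun y hy ↦ ContinuousAt.continuousWithinAt ?_
  rw [uIcc_of_le hY] at hy
  have : y ≠ 0 := by linarith [hy.1]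
  fun_prop (disch := assumption)

lemma integral_log_sub_log_div (hY : 1 ≤ Y) :
    ∫ y in 1..Y, (Real.log Y - Real.log y) / y = Real.log Y ^ 2 / 2 := by
  have hderiv (y : ℝ) (hy : y ∈ uIcc 1 Y) :
      HasDerivAt (fun y ↦ -((Real.log Y - Real.log y) ^ 2 / 2))
        ((Real.log Y - Real.log y) / y) y := by
    rw [uIcc_of_le hY] at hy
    have hy₀ : y ≠ 0 := by linarith [hy.1]
    refine ((((Real.hasDerivAt_log hy₀).const_sub _).pow 2).div_const 2).neg.congr_deriv ?_
    push_cast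
    field_simp
  rw [intervalIntegral.integral_eq_sub_of_hasDerivAt hderiv (intervalIntegrable_log_sub_log_div hY)]
  simp

lemma integrableOn_and_integral_log_sub_log_mul_rpow (hY : 0 < Y) (hσ : 0 < σ) :
    IntegrableOn (fun y ↦ (Real.log y - Real.log Y) * y ^ (-σ - 1)) (Ioi Y) ∧
      ∫ y in Ioi Y, (Real.log y - Real.log Y) * y ^ (-σ - 1) = Y ^ (-σ) / σ ^ 2 := by
  let G (y : ℝ) : ℝ := -(((Real.log y - Real.log Y) / σ + 1 / σ ^ 2) * y ^ (-σ))
  have hderiv (y : ℝ) (hy : Y ≤ y) :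
      HasDerivAt G ((Real.log y - Real.log Y) * y ^ (-σ - 1)) y := by
    have hy₀ : y ≠ 0 := (hY.trans_le hy).ne'
    have hpow : y ^ (-σ) = y ^ (-σ - 1) * y := by
      rw [Real.rpow_sub_one hy₀, div_mul_cancel₀ _ hy₀]
    refine HasDerivAt.congr_deriv (((((Real.hasDerivAt_log hy₀).sub_const _).div_const σ).add_const
      (1 / σ ^ 2)).mul (Real.hasDerivAt_rpow_const (p := -σ) (Or.inl hy₀))).neg ?_
    rw [hpow]
    field_simp
    ring
  have hlim : Tendsto G atTop (𝓝 0) := by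
    have rpow_lim : Tendsto (fun y : ℝ ↦ y ^ (-σ)) atTop (𝓝 0) := tendsto_rpow_neg_atTop hσ
    have log_mul_rpow_lim : Tendsto (fun y : ℝ ↦ Real.log y * y ^ (-σ)) atTop (𝓝 0) := by
      refine (isLittleO_log_rpow_atTop hσ).tendsto_div_nhds_zero.congr' ?_
      filter_upwards [eventually_gt_atTop 0] with y hy
      rw [Real.rpow_neg hy.le, div_eq_mul_inv]
    have lim := ((log_mul_rpow_lim.const_mul (1 / σ)).add
      (rpow_lim.const_mul (1 / σ ^ 2 - Real.log Y / σ))).neg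
    rw [mul_zero, mul_zero, add_zero, neg_zero] at lim
    refine lim.congr fun y ↦ ?_
    simp only [G]
    ring
  have hpos (y : ℝ) (hy : Y < y) : 0 ≤ (Real.log y - Real.log Y) * y ^ (-σ - 1) :=
    mul_nonneg (sub_nonneg.mpr (Real.log_le_log hY hy.le)) (Real.rpow_nonneg (hY.trans hy).le _)
  refine ⟨integrableOn_Ioi_deriv_of_nonneg' hderiv hpos hlim, ?_⟩
  rw [integral_Ioi_of_hasDerivAt_of_nonneg' hderiv hpos hlim]
  simp only [G]
  ring

lemma rpow_mul_abs_log_sub_log_mul_le_of_le {y F : ℝ} (hy : 0 < y) (hyY : y ≤ Y) (hσ : σ ≤ 1)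
    (hF : F ≤ y ^ 2 / 4) : y ^ (-σ - 2) * (|Real.log y - Real.log Y| * F) ≤
      Y ^ (1 - σ) / 4 * ((Real.log Y - Real.log y) / y) := by
  have hlog : 0 ≤ Real.log Y - Real.log y := sub_nonneg.mpr (Real.log_le_log hy hyY)
  have hpow : y ^ (-σ - 2) * y ^ 2 = y ^ (1 - σ) / y := by
    rw [← Real.rpow_sub_one hy.ne', ← Real.rpow_add_natCast hy.ne']
    push_cast
    ring_nf
  rw [abs_sub_comm, abs_of_nonneg hlog]
  calc y ^ (-σ - 2) * ((Real.log Y - Real.log y) * F)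
      ≤ y ^ (-σ - 2) * ((Real.log Y - Real.log y) * (y ^ 2 / 4)) := by gcongr
    _ = y ^ (1 - σ) / 4 * ((Real.log Y - Real.log y) / y) := by
        linear_combination (Real.log Y - Real.log y) / 4 * hpow
    _ ≤ Y ^ (1 - σ) / 4 * ((Real.log Y - Real.log y) / y) := by
        gcongr

lemma rpow_mul_abs_log_sub_log_mul_le_of_ge {y F C : ℝ} (hY : 0 < Y) (hyY : Y ≤ y)
    (hF : F ≤ C * (y / 2)) : y ^ (-σ - 2) * (|Real.log y - Real.log Y| * F) ≤
      C / 2 * ((Real.log y - Real.log Y) * y ^ (-σ - 1)) := by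
  have hy : 0 < y := hY.trans_le hyY
  have hlog : 0 ≤ Real.log y - Real.log Y := sub_nonneg.mpr (Real.log_le_log hY hyY)
  have hpow : y ^ (-σ - 2) * y = y ^ (-σ - 1) := by
    rw [← Real.rpow_add_one hy.ne']
    ring_nf
  rw [abs_of_nonneg hlog]
  calc y ^ (-σ - 2) * ((Real.log y - Real.log Y) * F)
      ≤ y ^ (-σ - 2) * ((Real.log y - Real.log Y) * (C * (y / 2))) := by gcongr
    _ = C / 2 * ((Real.log y - Real.log Y) * y ^ (-σ - 1)) := by
        linear_combination (Real.log y - Real.log Y) * C / 2 * hpow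

lemma norm_cpow_smul_log_sub_log_smul_le {f : ℝ → ℂ} {y C : ℝ} (hY : 1 ≤ Y) (hσ : σ ≤ 1)
    (hf₀ : ∀ y ≤ 1, f y = 0) (hf_sq : ∀ y, 0 ≤ y → ‖f y‖ ≤ y ^ 2 / 4)
    (hf_lin : ∀ y, 0 ≤ y → ‖f y‖ ≤ C * (y / 2)) (hy : 0 < y) :
    ‖(y : ℂ) ^ (-(σ : ℂ) - 1 - 1) • (Real.log y - Real.log Y) • f y‖ ≤
      (Ioc 1 Y).indicator (fun y ↦ Y ^ (1 - σ) / 4 * ((Real.log Y - Real.log y) / y)) y +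
        (Ioi Y).indicator (fun y ↦ C / 2 * ((Real.log y - Real.log Y) * y ^ (-σ - 1))) y := by
  have norm_cpow : ‖(y : ℂ) ^ (-(σ : ℂ) - 1 - 1)‖ = y ^ (-σ - 2) := by
    rw [Complex.norm_cpow_eq_rpow_re_of_pos hy]
    simp [sub_sub, one_add_one_eq_two]
  rw [norm_smul, norm_smul, norm_cpow, Real.norm_eq_abs]
  rcases le_or_gt y 1 with hy₁ | hy₁
  · simp [hf₀ y hy₁, hy₁.not_gt, (hy₁.trans hY).not_gt]
  rcases le_or_gt y Y with hyY | hyY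
  · rw [indicator_of_mem (show y ∈ Ioc 1 Y from ⟨hy₁, hyY⟩),
      indicator_of_notMem (show y ∉ Ioi Y from hyY.not_gt), add_zero]
    exact rpow_mul_abs_log_sub_log_mul_le_of_le hy hyY hσ (hf_sq y hy.le)
  · rw [indicator_of_notMem (show y ∉ Ioc 1 Y from fun h ↦ hyY.not_ge h.2),
      indicator_of_mem (show y ∈ Ioi Y from hyY), zero_add]
    exact rpow_mul_abs_log_sub_log_mul_le_of_ge (one_pos.trans_le hY) hyY.le (hf_lin y hy.le)

lemma norm_mellin_log_sub_log_smul_le {f : ℝ → ℂ} {C : ℝ} (hY : 1 ≤ Y) (hσ : 0 < σ) (hσ₁ : σ ≤ 1)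
    (hf₀ : ∀ y ≤ 1, f y = 0) (hf_sq : ∀ y, 0 ≤ y → ‖f y‖ ≤ y ^ 2 / 4)
    (hf_lin : ∀ y, 0 ≤ y → ‖f y‖ ≤ C * (y / 2)) :
    ‖mellin (fun y ↦ (Real.log y - Real.log Y) • f y) (-σ - 1)‖ ≤
      Y ^ (1 - σ) * Real.log Y ^ 2 / 8 + C * Y ^ (-σ) / (2 * σ ^ 2) := by
  have hY₀ : 0 < Y := one_pos.trans_le hY
  let g₁ (y : ℝ) : ℝ := Y ^ (1 - σ) / 4 * ((Real.log Y - Real.log y) / y)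
  let g₂ (y : ℝ) : ℝ := C / 2 * ((Real.log y - Real.log Y) * y ^ (-σ - 1))
  obtain ⟨integrable_tail, integral_tail⟩ := integrableOn_and_integral_log_sub_log_mul_rpow hY₀ hσ
  have integral_g₁ : ∫ y in Ioc 1 Y, g₁ y = Y ^ (1 - σ) * Real.log Y ^ 2 / 8 := by
    rw [integral_const_mul, ← intervalIntegral.integral_of_le hY, integral_log_sub_log_div hY]
    ring
  have integral_g₂ : ∫ y in Ioi Y, g₂ y = C * Y ^ (-σ) / (2 * σ ^ 2) := by
    rw [integral_const_mul, integral_tail]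
    ring
  have integrable_g₁ : IntegrableOn ((Ioc 1 Y).indicator g₁) (Ioi 0) :=
    (IntegrableOn.integrable_indicator (((intervalIntegrable_iff_integrableOn_Ioc_of_le hY).mp
      (intervalIntegrable_log_sub_log_div hY)).const_mul _) measurableSet_Ioc).integrableOn
  have integrable_g₂ : IntegrableOn ((Ioi Y).indicator g₂) (Ioi 0) :=
    (IntegrableOn.integrable_indicator (integrable_tail.const_mul _)
      measurableSet_Ioi).integrableOn
  have integral_majorant : ∫ y in Ioi 0, ((Ioc 1 Y).indicator g₁ y + (Ioi Y).indicator g₂ y) =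
      Y ^ (1 - σ) * Real.log Y ^ 2 / 8 + C * Y ^ (-σ) / (2 * σ ^ 2) := by
    rw [integral_add integrable_g₁ integrable_g₂, setIntegral_indicator measurableSet_Ioc,
      setIntegral_indicator measurableSet_Ioi,
      inter_eq_right.mpr (Ioc_subset_Ioi_self.trans (Ioi_subset_Ioi zero_le_one)),
      inter_eq_right.mpr (Ioi_subset_Ioi hY₀.le), integral_g₁, integral_g₂]
  rw [← integral_majorant]
  refine norm_integral_le_of_norm_le (integrable_g₁.add integrable_g₂) ?_
  filter_upwards [ae_restrict_mem measurableSet_Ioi] with y (hy : 0 < y)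
  exact norm_cpow_smul_log_sub_log_smul_le hY hσ₁ hf₀ hf_sq hf_lin hy

end LogIntegrals

section TentWeight

variable {σ : ℝ}

/-- The weight `w(x) = x (x + 1) / (1 - 2⁻ˣ)` by which the Mellin transform of `tentSum a` at
`-x - 1` has to be multiplied to recover the Dirichlet series `∑ a(n) n⁻ˣ`. At `x = 0`, where the
denominator vanishes, it has the junk value `0`. -/
noncomputable def tentWeight (x : ℝ) : ℝ := x * (x + 1) / (1 - 2 ^ (-x))

lemma two_rpow_neg_le_one_sub_half (hσ₀ : 0 ≤ σ) (hσ₁ : σ ≤ 1) :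
    (2 : ℝ) ^ (-σ) ≤ 1 - σ / 2 := by
  have bernoulli := rpow_one_add_le_one_add_mul_self (s := -(1 / 2)) (by norm_num) hσ₀ hσ₁
  rw [Real.rpow_neg zero_le_two, ← Real.inv_rpow zero_le_two]
  convert bernoulli using 1
  · norm_num
  · ring

lemma one_sub_two_rpow_neg_pos (hσ : 0 < σ) : 0 < 1 - (2 : ℝ) ^ (-σ) :=
  sub_pos.mpr (Real.rpow_lt_one_of_one_lt_of_neg one_lt_two (neg_lt_zero.mpr hσ))

lemma tentWeight_pos (hσ : 0 < σ) : 0 < tentWeight σ :=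
  div_pos (by positivity) (one_sub_two_rpow_neg_pos hσ)

lemma tentWeight_le_four (hσ : 0 < σ) (hσ₁ : σ ≤ 1) : tentWeight σ ≤ 4 := by
  rw [tentWeight, div_le_iff₀ (one_sub_two_rpow_neg_pos hσ)]
  nlinarith [two_rpow_neg_le_one_sub_half hσ.le hσ₁]

lemma hasDerivAt_tentWeight (hσ : 0 < σ) :
    HasDerivAt tentWeight (((2 * σ + 1) / (σ * (σ + 1)) -
      Real.log 2 * 2 ^ (-σ) / (1 - 2 ^ (-σ))) * tentWeight σ) σ := by
  have hden : HasDerivAt (fun x : ℝ ↦ 1 - (2 : ℝ) ^ (-x)) (Real.log 2 * 2 ^ (-σ)) σ :=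
    (((hasDerivAt_id σ).neg.const_rpow two_pos).const_sub 1).congr_deriv (by simp)
  have hden₀ := (one_sub_two_rpow_neg_pos hσ).ne'
  refine (((hasDerivAt_id σ).mul ((hasDerivAt_id σ).add_const 1)).div hden hden₀).congr_deriv ?_
  simp only [id, tentWeight, Pi.mul_apply]
  field_simp
  ring

lemma logDeriv_tentWeight_mem_Icc (hσ : 3 / 4 ≤ σ) (hσ₁ : σ ≤ 1) :
    logDeriv tentWeight σ ∈ Set.Icc 0 2 := by
  have hσ₀ : 0 < σ := by linarith
  have hden := one_sub_two_rpow_neg_pos hσ₀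
  have hpow := two_rpow_neg_le_one_sub_half hσ₀.le hσ₁
  have quot_nonneg : 0 ≤ Real.log 2 * 2 ^ (-σ) / (1 - 2 ^ (-σ)) := by positivity
  have quot_le : Real.log 2 * 2 ^ (-σ) / (1 - 2 ^ (-σ)) ≤ 5 / 4 := by
    rw [div_le_iff₀ hden]
    calc Real.log 2 * 2 ^ (-σ) ≤ 0.7 * 2 ^ (-σ) := by
          gcongr
          linarith [Real.log_two_lt_d9]
      _ ≤ 5 / 4 * (1 - 2 ^ (-σ)) := by linarith
  have rational_le : (2 * σ + 1) / (σ * (σ + 1)) ≤ 2 := by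
    rw [div_le_iff₀ (by positivity)]
    nlinarith
  have le_rational : 5 / 4 ≤ (2 * σ + 1) / (σ * (σ + 1)) := by
    rw [le_div_iff₀ (by positivity)]
    nlinarith
  rw [logDeriv_apply, (hasDerivAt_tentWeight hσ₀).deriv,
    mul_div_cancel_right₀ _ (tentWeight_pos hσ₀).ne']
  constructor <;> linarith

end TentWeight

section DerivLFunction

open Complex Filter Topology

open scoped ZMod

variable {q : ℕ} [NeZero q] {Φ : ZMod q → ℂ} {σ : ℝ}

lemma LFunction_eq_tentWeight_mul_mellin_tentSum (hΦ₀ : ∑ x, Φ x = 0) (hσ : 0 < σ) :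
    ZMod.LFunction Φ σ = tentWeight σ * mellin (tentSum (Φ ·)) (-σ - 1) := by
  have hcast : ((1 - 2 ^ (-σ) : ℝ) : ℂ) = 1 - 2 ^ (-(σ : ℂ)) := by
    push_cast [ofReal_cpow zero_le_two]
    rfl
  have hden : (1 : ℂ) - 2 ^ (-(σ : ℂ)) ≠ 0 := by
    rw [← hcast]
    exact ofReal_ne_zero.mpr (one_sub_two_rpow_neg_pos hσ).ne'
  have h := mul_mellin_tentSum_eq_mul_LFunction hΦ₀ (s := σ) (by simpa using hσ)
  rw [tentWeight, ofReal_div, hcast]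
  push_cast
  rw [div_mul_eq_mul_div, h, mul_div_cancel_left₀ _ hden]

lemma mellin_log_sub_log_smul_tentSum (hΦ₀ : ∑ x, Φ x = 0) {s : ℂ} (hs : 0 < s.re) (Y : ℝ) :
    mellin (fun y ↦ (Real.log y - Real.log Y) • tentSum (Φ ·) y) (-s - 1) =
      mellin (fun y ↦ Real.log y • tentSum (Φ ·) y) (-s - 1) -
        Real.log Y * mellin (tentSum (Φ ·)) (-s - 1) := by
  have h₁ := (mellinConvergent_log_smul_and_hasDerivAt_mellin_tentSum hΦ₀ hs).1
  have h₂ := (mellinConvergent_tentSum hΦ₀ hs).const_smul (Real.log Y)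
  simp only [sub_smul]
  rw [(hasMellin_sub h₁ h₂).2, mellin_const_smul, real_smul]

lemma deriv_LFunction_eq_sub_mellin_log_sub_log (hΦ₀ : ∑ x, Φ x = 0) (hσ : 0 < σ) (Y : ℝ) :
    deriv (ZMod.LFunction Φ) σ =
      ((logDeriv tentWeight σ - Real.log Y : ℝ) : ℂ) * ZMod.LFunction Φ σ -
        tentWeight σ *
          mellin (fun y ↦ (Real.log y - Real.log Y) • tentSum (Φ ·) y) (-σ - 1) := by
  have hs : 0 < (σ : ℂ).re := by simpa using hσ
  have hw := (hasDerivAt_tentWeight hσ).differentiableAt.hasDerivAt.ofReal_comp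
  have hm := (mellinConvergent_log_smul_and_hasDerivAt_mellin_tentSum hΦ₀ hs).2.comp_ofReal
  have hL := (ZMod.differentiable_LFunction_of_sum_zero hΦ₀ σ).hasDerivAt.comp_ofReal
  have heq : (fun x : ℝ ↦ ZMod.LFunction Φ x) =ᶠ[𝓝 σ]
      fun x : ℝ ↦ tentWeight x * mellin (tentSum (Φ ·)) (-x - 1) := by
    filter_upwards [lt_mem_nhds hσ] with x hx
    exact LFunction_eq_tentWeight_mul_mellin_tentSum hΦ₀ hx
  have hderiv := hL.unique ((hw.mul hm).congr_of_eventuallyEq heq)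
  have hw₀ : (tentWeight σ : ℂ) ≠ 0 := ofReal_ne_zero.mpr (tentWeight_pos hσ).ne'
  rw [hderiv, mellin_log_sub_log_smul_tentSum hΦ₀ hs,
    LFunction_eq_tentWeight_mul_mellin_tentSum hΦ₀ hσ, logDeriv_apply]
  push_cast
  field_simp
  ring

lemma norm_deriv_LFunction_le_log_mul_norm_add {Y : ℝ} (hΦ : ∀ x, ‖Φ x‖ ≤ 1)
    (hΦ₀ : ∑ x, Φ x = 0) (hΦY : ∀ k, ‖𝓕 Φ k‖ ≤ 2 * Y) (hY : 0 < Y) (hlog : 1 ≤ Real.log Y)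
    (hσ : 3 / 4 ≤ σ) (hσ₁ : σ ≤ 1) :
    ‖deriv (ZMod.LFunction Φ) σ‖ ≤ Real.log Y * ‖ZMod.LFunction Φ σ‖ +
      Y ^ (1 - σ) * (Real.log Y ^ 2 / 2 + 4 / σ ^ 2) := by
  have hσ₀ : 0 < σ := by linarith
  have hY₁ : 1 ≤ Y := (Real.log_nonneg_iff hY).mp (by linarith)
  have hpow : Y ^ (1 - σ) = Y * Y ^ (-σ) := by
    rw [sub_eq_add_neg, Real.rpow_add hY, Real.rpow_one]
  have hcoeff : ‖((logDeriv tentWeight σ - Real.log Y : ℝ) : ℂ)‖ ≤ Real.log Y := by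
    obtain ⟨h₀, h₂⟩ := logDeriv_tentWeight_mem_Icc hσ hσ₁
    rw [norm_real, Real.norm_eq_abs, abs_le]
    constructor <;> linarith
  have hmellin := norm_mellin_log_sub_log_smul_le hY₁ hσ₀ hσ₁
    (fun y hy ↦ tentSum_eq_zero (Φ ·) hy) (fun y hy ↦ norm_tentSum_le_sq (fun n ↦ hΦ n) hy)
    (fun y hy ↦ norm_tentSum_le_of_norm_dft_le hΦ₀ hΦY hy)
  rw [deriv_LFunction_eq_sub_mellin_log_sub_log hΦ₀ hσ₀ Y]
  refine (norm_sub_le _ _).trans ?_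
  rw [norm_mul, norm_mul, norm_real (tentWeight σ), Real.norm_of_nonneg (tentWeight_pos hσ₀).le]
  refine add_le_add (by gcongr) ?_
  calc tentWeight σ * ‖mellin (fun y ↦ (Real.log y - Real.log Y) • tentSum (Φ ·) y) (-σ - 1)‖
      ≤ 4 * (Y ^ (1 - σ) * Real.log Y ^ 2 / 8 + 2 * Y * Y ^ (-σ) / (2 * σ ^ 2)) := by
        gcongr
        exact tentWeight_le_four hσ₀ hσ₁
    _ = Y ^ (1 - σ) * (Real.log Y ^ 2 / 2 + 4 / σ ^ 2) := by
        rw [hpow]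
        ring

lemma norm_deriv_le_mul_exp_of_norm_deriv_le {E : Type*} [NormedAddCommGroup E] [NormedSpace ℝ E]
    {f f' : ℝ → E} {K ε a b : ℝ} (hK : 0 < K) (hf : ∀ x ∈ Set.Icc a b, HasDerivAt f (f' x) x)
    (ha : f a = 0) (bound : ∀ x ∈ Set.Icc a b, ‖f' x‖ ≤ K * ‖f x‖ + ε) :
    ∀ x ∈ Set.Icc a b, ‖f' x‖ ≤ ε * Real.exp (K * (x - a)) := by
  intro x hx
  have hfx := norm_le_gronwallBound_of_norm_deriv_right_le
    (fun y hy ↦ (hf y hy).continuousAt.continuousWithinAt)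
    (fun y hy ↦ (hf y (Set.Ico_subset_Icc_self hy)).hasDerivWithinAt) (norm_le_zero_iff.mpr ha)
    (fun y hy ↦ bound y (Set.Ico_subset_Icc_self hy)) x hx
  simp only [gronwallBound_of_K_ne_0 hK.ne', zero_mul, zero_add] at hfx
  calc ‖f' x‖ ≤ K * ‖f x‖ + ε := bound x hx
    _ ≤ K * (ε / K * (Real.exp (K * (x - a)) - 1)) + ε := by gcongr
    _ = ε * Real.exp (K * (x - a)) := by
        field_simp
        ring

lemma norm_deriv_LFunction_le_of_LFunction_eq_zero {Y β : ℝ} (hΦ : ∀ x, ‖Φ x‖ ≤ 1)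
    (hΦ₀ : ∑ x, Φ x = 0) (hΦY : ∀ k, ‖𝓕 Φ k‖ ≤ 2 * Y) (hY : 0 < Y) (hlog : 1 ≤ Real.log Y)
    (hβ : 3 / 4 ≤ β) (hzero : ZMod.LFunction Φ β = 0) (hσ : σ ∈ Set.Icc β 1) :
    ‖deriv (ZMod.LFunction Φ) σ‖ ≤
      Real.exp (2 * ((1 - β) * Real.log Y)) * (Real.log Y ^ 2 / 2 + 4 / β ^ 2) := by
  have hY₁ : 1 ≤ Y := (Real.log_nonneg_iff hY).mp (by linarith)
  have growth := norm_deriv_le_mul_exp_of_norm_deriv_le (f := fun x : ℝ ↦ ZMod.LFunction Φ x)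
    (f' := fun x : ℝ ↦ deriv (ZMod.LFunction Φ) x) (K := Real.log Y) (b := 1)
    (ε := Y ^ (1 - β) * (Real.log Y ^ 2 / 2 + 4 / β ^ 2)) (by linarith)
    (fun x _ ↦ (ZMod.differentiable_LFunction_of_sum_zero hΦ₀ x).hasDerivAt.comp_ofReal) hzero
    (fun x hx ↦ ?_) σ hσ
  · calc ‖deriv (ZMod.LFunction Φ) σ‖
        ≤ Y ^ (1 - β) * (Real.log Y ^ 2 / 2 + 4 / β ^ 2) *
            Real.exp (Real.log Y * (σ - β)) := growth
      _ ≤ Y ^ (1 - β) * (Real.log Y ^ 2 / 2 + 4 / β ^ 2) *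
            Real.exp (Real.log Y * (1 - β)) := by
          gcongr
          exact hσ.2
      _ = Real.exp (2 * ((1 - β) * Real.log Y)) * (Real.log Y ^ 2 / 2 + 4 / β ^ 2) := by
          rw [Real.rpow_def_of_pos hY, mul_right_comm, ← Real.exp_add]
          ring_nf
  · obtain ⟨hβx, hx₁⟩ := hx
    refine (norm_deriv_LFunction_le_log_mul_norm_add hΦ hΦ₀ hΦY hY hlog (hβ.trans hβx) hx₁).trans ?_
    gcongr

end DerivLFunction

section ExceptionalZero

variable {q : ℕ} [NeZero q] {χ : DirichletCharacter ℂ q} {β : ℝ}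

lemma IsExceptionalZero.one_sub_mul_log_le (hβ : IsExceptionalZero χ β) (hq : 10 ≤ q) :
    (1 - β) * Real.log q ≤ 9.6459⁻¹ := by
  have hq' : (10 : ℝ) ≤ q := by exact_mod_cast hq
  have hlog : 0 < Real.log q := Real.log_pos (by linarith)
  have hβ₁ := hβ.1
  rw [max_eq_left hq'] at hβ₁
  calc (1 - β) * Real.log q ≤ (9.6459 * Real.log q)⁻¹ * Real.log q := by
        gcongr
        linarith
    _ = 9.6459⁻¹ := by field_simp

lemma exp_two_mul_mul_log_le_inv_one_sub {x y δ c : ℝ} (hc : c < 1) (hy : 0 < y)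
    (hyx : y ^ 2 ≤ x) (hδ : 0 ≤ δ) (hδx : δ * Real.log x ≤ c) :
    Real.exp (2 * (δ * Real.log y)) ≤ (1 - c)⁻¹ := by
  have hlog : 2 * Real.log y ≤ Real.log x := by
    simpa using Real.log_le_log (by positivity) hyx
  have hle : 2 * (δ * Real.log y) ≤ c := by nlinarith
  rw [← neg_neg (2 * (δ * Real.log y)), Real.exp_neg]
  exact inv_anti₀ (by linarith) (by linarith [Real.add_one_le_exp (-(2 * (δ * Real.log y)))])

lemma norm_deriv_LFunction_le_of_isExceptionalZero {σ : ℝ} (hχ : χ.IsPrimitive)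
    (hβ : IsExceptionalZero χ β) (hq : 2 ^ 8 ≤ q) (hσ : σ ∈ Set.Icc β 1) :
    ‖deriv (DirichletCharacter.LFunction χ) σ‖ ≤
      (1 - 9.6459⁻¹)⁻¹ * ((Real.log q / 2 - Real.log 2) ^ 2 / 2 + 4 / β ^ 2) := by
  have hq' : (2 ^ 8 : ℝ) ≤ q := by exact_mod_cast hq
  have hq₀ : (0 : ℝ) < q := by linarith
  have hlogY : Real.log (√q / 2) = Real.log q / 2 - Real.log 2 := by
    rw [Real.log_div (by positivity) two_ne_zero, Real.log_sqrt hq₀.le]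
  have hlogq : 8 * Real.log 2 ≤ Real.log q := by
    simpa using Real.log_le_log (by norm_num) hq'
  have hlog2 := Real.log_two_gt_d9
  have hδ := hβ.one_sub_mul_log_le (by lia)
  have hβ₁ : β ≤ 1 := hσ.1.trans hσ.2
  have hβ₀ : 3 / 4 ≤ β := by
    norm_num at hδ
    nlinarith
  refine (norm_deriv_LFunction_le_of_LFunction_eq_zero (Φ := χ) (Y := √q / 2) χ.norm_le_one
    (sum_eq_zero_of_isPrimitive hχ (by lia)) (fun k ↦ ?_) (by positivity) (by linarith) hβ₀ hβ.2
    hσ).trans ?_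
  · rw [mul_div_cancel₀ _ two_ne_zero]
    exact norm_dft_le_sqrt_of_isPrimitive hχ k
  · rw [← hlogY]
    gcongr
    refine exp_two_mul_mul_log_le_inv_one_sub (by norm_num) (by positivity) ?_ (by linarith) hδ
    rw [div_pow, Real.sq_sqrt hq₀.le]
    linarith

end ExceptionalZero

theorem theorem1_general (q : ℕ) [NeZero q] (χ : DirichletCharacter ℂ q) (hprim : χ.IsPrimitive)
    (β₀ : ℝ) (hβ₀ : IsExceptionalZero χ β₀) (hq : 2 ^ 15 ≤ q) (σ : ℝ) (hσ : σ ∈ Set.Icc β₀ 1) :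
    ‖deriv (DirichletCharacter.LFunction χ) (σ : ℂ)‖ ≤ 0.15 * Real.log (q : ℝ) ^ 2 := by
  have hlogq : 15 * Real.log 2 ≤ Real.log q := by
    simpa using Real.log_le_log (by norm_num) (show (2 ^ 15 : ℝ) ≤ q by exact_mod_cast hq)
  have hlog2 := Real.log_two_gt_d9
  have hδ := hβ₀.one_sub_mul_log_le (by lia)
  have hβ : 0.99 ≤ β₀ := by
    norm_num at hδ
    nlinarith [hσ.1.trans hσ.2]
  calc ‖deriv (DirichletCharacter.LFunction χ) (σ : ℂ)‖
      ≤ (1 - 9.6459⁻¹)⁻¹ * ((Real.log q / 2 - Real.log 2) ^ 2 / 2 + 4 / β₀ ^ 2) :=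
        norm_deriv_LFunction_le_of_isExceptionalZero hprim hβ₀ (by lia) hσ
    _ ≤ 1.116 * ((Real.log q / 2 - 0.693) ^ 2 / 2 + 4 / 0.99 ^ 2) := by
        gcongr
        · norm_num
        · linarith
        · linarith
    _ ≤ 0.15 * Real.log q ^ 2 := by nlinarith

theorem theorem1 (q : ℕ) [NeZero q] (χ : DirichletCharacter ℂ q)
    (hprim : χ.IsPrimitive) (hreal : MulChar.IsQuadratic χ)
    (β₀ : ℝ) (hβ₀ : IsExceptionalZero χ β₀)
    (σ : ℝ) (hσ : σ ∈ Set.Ioo β₀ 1) :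
    (χ.Odd → 4 * 10 ^ 5 < q →
        1 - 800 / (Real.sqrt (q : ℝ) * Real.log (q : ℝ) ^ 2) ≤ β₀ →
        ‖deriv (DirichletCharacter.LFunction χ) (σ : ℂ)‖ ≤ 0.18 * Real.log (q : ℝ) ^ 2) ∧
    (χ.Even → 4 * 10 ^ 5 < q →
        1 - 515 / (Real.sqrt (q : ℝ) * Real.log (q : ℝ) ^ 2) ≤ β₀ →
        ‖deriv (DirichletCharacter.LFunction χ) (σ : ℂ)‖ ≤ 0.1536 * Real.log (q : ℝ) ^ 2) ∧
    (χ.Even → 10 ^ 7 < q →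
        1 - 80 / (Real.sqrt (q : ℝ) * Real.log (q : ℝ) ^ 2) ≤ β₀ →
        ‖deriv (DirichletCharacter.LFunction χ) (σ : ℂ)‖ ≤ 0.15 * Real.log (q : ℝ) ^ 2) := by
  have weaken {c : ℝ} (hc : 0.15 ≤ c) (hq : 4 * 10 ^ 5 < q) :
      ‖deriv (DirichletCharacter.LFunction χ) (σ : ℂ)‖ ≤ c * Real.log (q : ℝ) ^ 2 :=
    (theorem1_general q χ hprim β₀ hβ₀ (by lia) σ (Set.Ioo_subset_Icc_self hσ)).trans (by gcongr)
  exact ⟨fun _ hq _ ↦ weaken (by norm_num) hq, fun _ hq _ ↦ weaken (by norm_num) hq,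
    fun _ hq _ ↦ weaken le_rfl (by lia)⟩
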